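/- Let $\mathbb{T}=\mathbb{R}/\mathbb{Z}$. For an integer $N\ge 1$ and a permutation $\sigma$ of $\{1,\dots,N\}$ define, for $f\in L^2(\mathbb{T})$ (complex-valued), $$T_{\sigma,N}f(x)=\max_{1\le m\le N}\left|\sum_{k=1}^m c_{\sigma(k)}e^{2\pi i\sigma(k)x}\right|,\qquad c_k=\int_{\mathbb{T}} f(x)e^{-2\pi i kx}\,dx,$$ and $\|T_{\sigma,N}\|_{L^2\to L^2}=\sup_{\|f\|_2\le 1}\|T_{\sigma,N}f\|_2$. There exist absolute constants $c,C>0$ such that for every integer $N>1$ there is a permutation $\sigma$ of $\{1,\dots,N\}$ with $$c\log N\le \|T_{\sigma,N}\|_{L^2\to L^2}\le C\log N.$$ -/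

import Mathlib

open MeasureTheory

/-- The space `L²(𝕋)` of complex-valued functions on the torus `𝕋 = ℝ/ℤ`, with respect to the
Haar probability measure (which is Lebesgue measure). -/
noncomputable abbrev L2Torus : Type :=
  Lp ℂ 2 (AddCircle.haarAddCircle : Measure UnitAddCircle)

/-- The rearranged trigonometric majorant
`T_{σ,N} f(x) = max_{1 ≤ m ≤ N} |∑_{k=1}^m c_{σ(k)} e^{2π i σ(k) x}|`, where `c_k` is the `k`-th
Fourier coefficient of `f`.  The index set `{1, …, N}` is `Fin N` shifted by one, and the maximum
is a supremum over the finite set of all `m`. -/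
noncomputable def trigMajorant {N : ℕ} (σ : Equiv.Perm (Fin N)) (f : L2Torus)
    (x : UnitAddCircle) : ℝ :=
  ⨆ m : Fin N, ‖∑ k ∈ Finset.Iic m,
    fourierCoeff (f : UnitAddCircle → ℂ) ((σ k : ℕ) + 1 : ℤ) *
      (fourier ((σ k : ℕ) + 1 : ℤ) x : ℂ)‖

/-- The `L² → L²` norm `sup_{‖f‖₂ ≤ 1} ‖T f‖₂` of a (not necessarily linear) operator `T`,
as an extended nonnegative number. -/
noncomputable def normL2L2 (T : L2Torus → UnitAddCircle → ℝ) : ENNReal :=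
  ⨆ (f : L2Torus) (_ : ‖f‖ ≤ 1), eLpNorm (T f) 2 (AddCircle.haarAddCircle : Measure UnitAddCircle)

/-! The upper bound holds for every order, by the Rademacher–Menshov argument. A partial sum splits
into at most `L` dyadic blocks, `L` about `log₂ N`. Cauchy–Schwarz bounds its square by `L` times
the sum of the squares of all blocks (`norm_sum_range_sq_le_dyadicSq`), and orthogonality on each of
the `L` levels bounds the integral of that sum by `L‖f‖²` (`integral_dyadicSq_fourier`).

For the lower bound, write frequencies as `R a + b` with `R = M²` and `b < a ≤ R`, order them by
slope `b / a`, and give them coefficients proportional to `1 / a`; the squared norm before scaling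
is the harmonic sum `∑ 1 / a`. If `R x = i - θ`, the phase of `R a + b` at `x` is `b x - a θ` modulo
1. Stopping at slope `θ / x` keeps exactly the negative phases. The sum over `b` is geometric: at
its upper end all phases lie in `[0, x]`, so the terms `1 / a` add up coherently to order `2 log M`,
while at `b = 0` the phases `-a θ` oscillate and leave only about `log M`, as `θ ≥ 1 / M`. Hence
this partial sum is at least of order `log M / x` (`le_norm_sector_sum`). After normalization the
squared majorant is at least of order `log M · (R / i)²` on an interval of length `i / (4 R²)` just
left of `i / R`. Summing over `i` gives `log M · ∑ 1 / i`, of order `(log M)²`. -/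

/-! ### `L²` norms as integrals of squares -/

theorem ofReal_le_eLpNorm_two {α : Type*} [MeasurableSpace α] {μ : Measure α} {g : α → ℝ}
    {A : ℝ} (h : ENNReal.ofReal (A ^ 2) ≤ ∫⁻ x, ENNReal.ofReal (g x ^ 2) ∂μ) :
    ENNReal.ofReal A ≤ eLpNorm g 2 μ := by
  rcases le_total A 0 with hA | hA
  · simp [ENNReal.ofReal_of_nonpos hA]
  have h2 := eLpNorm_nnreal_pow_eq_lintegral (μ := μ) (f := g) (p := 2) (by norm_num)
  have h3 : ∀ x, ‖g x‖ₑ ^ ((2 : NNReal) : ℝ) = ENNReal.ofReal (g x ^ 2) := fun x ↦ by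
    rw [← sq_abs, ENNReal.ofReal_pow (abs_nonneg _), ← Real.enorm_eq_ofReal_abs]
    norm_num
  simp only [h3] at h2
  rw [← h2, ENNReal.ofReal_pow hA] at h
  refine (ENNReal.pow_le_pow_left_iff two_ne_zero).1 ?_
  convert h using 1
  norm_num

theorem eLpNorm_two_le_ofReal {α : Type*} [MeasurableSpace α] {μ : Measure α} {g : α → ℝ}
    {A : ℝ} (hA : 0 ≤ A) (h : ∫⁻ x, ENNReal.ofReal (g x ^ 2) ∂μ ≤ ENNReal.ofReal (A ^ 2)) :
    eLpNorm g 2 μ ≤ ENNReal.ofReal A := by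
  have h2 := eLpNorm_nnreal_pow_eq_lintegral (μ := μ) (f := g) (p := 2) (by norm_num)
  have h3 : ∀ x, ‖g x‖ₑ ^ ((2 : NNReal) : ℝ) = ENNReal.ofReal (g x ^ 2) := fun x ↦ by
    rw [← sq_abs, ENNReal.ofReal_pow (abs_nonneg _), ← Real.enorm_eq_ofReal_abs]
    norm_num
  simp only [h3] at h2
  rw [← h2, ENNReal.ofReal_pow hA] at h
  refine (ENNReal.pow_le_pow_left_iff two_ne_zero).1 ?_
  convert h using 1
  norm_num

/-! ### The Rademacher–Menshov upper bound -/

/-- The sum of `‖B‖ ^ 2` over the sums `B` of `a` on all left halves of dyadic subintervals of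
`[s, s + 2 ^ L)`. -/
noncomputable def dyadicSq (a : ℕ → ℂ) : ℕ → ℕ → ℝ
  | 0, _ => 0
  | L + 1, s => ‖∑ k ∈ Finset.range (2 ^ L), a (s + k)‖ ^ 2 +
      (dyadicSq a L s + dyadicSq a L (s + 2 ^ L))

theorem dyadicSq_nonneg (a : ℕ → ℂ) (L s : ℕ) : 0 ≤ dyadicSq a L s := by
  induction L generalizing s with
  | zero => exact le_rfl
  | succ L ih =>
    have := ih s
    have := ih (s + 2 ^ L)
    rw [dyadicSq]
    positivity

theorem norm_sum_range_sq_le_dyadicSq (a : ℕ → ℂ) (L s m : ℕ) (hm : m < 2 ^ L) :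
    ‖∑ k ∈ Finset.range m, a (s + k)‖ ^ 2 ≤ L * dyadicSq a L s := by
  induction L generalizing s m with
  | zero =>
    obtain rfl : m = 0 := by simpa using hm
    simp
  | succ L ih =>
    have h1 := dyadicSq_nonneg a L s
    have h2 := dyadicSq_nonneg a L (s + 2 ^ L)
    rw [dyadicSq]
    push_cast
    rcases lt_or_ge m (2 ^ L) with h | h
    · have := ih s m h
      have h3 : (0 : ℝ) ≤ L := Nat.cast_nonneg L
      have h4 : 0 ≤ ‖∑ k ∈ Finset.range (2 ^ L), a (s + k)‖ ^ 2 := by positivity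
      nlinarith [mul_nonneg h3 h2, mul_nonneg h3 h4]
    · obtain ⟨r, rfl⟩ := Nat.exists_eq_add_of_le h
      have hr := ih (s + 2 ^ L) r (by rw [pow_succ] at hm; omega)
      rw [Finset.sum_range_add]
      simp only [← add_assoc] at hr ⊢
      set B := ∑ k ∈ Finset.range (2 ^ L), a (s + k)
      set D := ∑ k ∈ Finset.range r, a (s + 2 ^ L + k)
      have h3 : (0 : ℝ) ≤ L := Nat.cast_nonneg L
      have hn := norm_add_le B D
      set G := dyadicSq a L (s + 2 ^ L)
      have h5 : ‖B + D‖ ^ 2 ≤ (‖B‖ + ‖D‖) ^ 2 := by gcongr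
      -- AM–GM with `‖D‖² ≤ L G`; it yields `(‖B‖ + ‖D‖)² ≤ (L + 1)(‖B‖² + G)`.
      have h6 : 2 * ‖B‖ * ‖D‖ ≤ L * ‖B‖ ^ 2 + G := by
        have h7 : (2 * ‖B‖ * ‖D‖) ^ 2 ≤ (L * ‖B‖ ^ 2 + G) ^ 2 := by
          have h8 : ‖B‖ ^ 2 * ‖D‖ ^ 2 ≤ ‖B‖ ^ 2 * (L * G) := by gcongr
          nlinarith [sq_nonneg (L * ‖B‖ ^ 2 - G)]
        exact (pow_le_pow_iff_left₀ (by positivity) (by positivity) two_ne_zero).1 h7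
      nlinarith [mul_nonneg h3 h1]

theorem continuous_dyadicSq {X : Type*} [TopologicalSpace X] {a : X → ℕ → ℂ}
    (ha : ∀ k, Continuous fun x ↦ a x k) (L s : ℕ) : Continuous fun x ↦ dyadicSq (a x) L s := by
  induction L generalizing s with
  | zero => simpa [dyadicSq] using continuous_const
  | succ L ih =>
    simp only [dyadicSq]
    have := ih s
    have := ih (s + 2 ^ L)
    fun_prop

/-- The Haar probability measure on `ℝ/ℤ`. -/
noncomputable abbrev haarT : Measure UnitAddCircle := AddCircle.haarAddCircle

theorem integral_norm_sq_sum_fourier {ι : Type*} (s : Finset ι) (c : ι → ℂ) (n : ι → ℤ)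
    (hn : Set.InjOn n s) :
    ∫ x, ‖∑ k ∈ s, c k * (fourier (n k) x : ℂ)‖ ^ 2 ∂haarT = ∑ k ∈ s, ‖c k‖ ^ 2 := by
  classical
  let p : C(UnitAddCircle, ℂ) := ∑ k ∈ s, c k • fourier (n k)
  have hp : ∀ x, p x = ∑ k ∈ s, c k * (fourier (n k) x : ℂ) := fun x ↦ by
    simp [p, ContinuousMap.sum_apply]
  have h1 := ContinuousMap.inner_toLp (𝕜 := ℂ) haarT p p
  have h2 : ContinuousMap.toLp 2 haarT ℂ p = ∑ k ∈ s, c k • fourierLp 2 (n k) := by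
    simp [p, map_sum, fourierLp]
  have h3 : inner ℂ (∑ k ∈ s, c k • fourierLp (T := 1) 2 (n k))
      (∑ k ∈ s, c k • fourierLp (T := 1) 2 (n k)) = ∑ k ∈ s, (starRingEnd ℂ) (c k) * c k := by
    simp only [sum_inner, inner_sum, inner_smul_left, inner_smul_right]
    refine Finset.sum_congr rfl fun i hi ↦ ?_
    rw [Finset.sum_eq_single i]
    · rw [orthonormal_iff_ite.1 orthonormal_fourier]
      simp [mul_comm]
    · intro j hj hji
      rw [orthonormal_iff_ite.1 orthonormal_fourier, if_neg]
      · simp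
      · intro h
        exact hji (hn hj hi h)
    · exact fun h ↦ absurd hi h
  rw [h2, h3] at h1
  have h4 : ((∫ x, ‖∑ k ∈ s, c k * (fourier (n k) x : ℂ)‖ ^ 2 ∂haarT : ℝ) : ℂ)
      = ((∑ k ∈ s, ‖c k‖ ^ 2 : ℝ) : ℂ) := by
    rw [← integral_complex_ofReal]
    push_cast
    simp only [← Complex.conj_mul']
    rw [h1]
    simp only [← hp, mul_comm]
  exact_mod_cast h4

/-- Blocks of one level are disjoint, so by orthogonality each level contributes at most the full
sum of squares. Frequencies need be distinct only where coefficients are nonzero, which permits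
padding by zeros. -/
theorem integral_dyadicSq_fourier (c : ℕ → ℂ) (n : ℕ → ℤ) (L s : ℕ)
    (hn : ∀ i j, n i = n j → c i ≠ 0 → c j ≠ 0 → i = j) :
    ∫ x, dyadicSq (fun k ↦ c k * (fourier (n k) x : ℂ)) L s ∂haarT ≤
      L * ∑ k ∈ Finset.range (2 ^ L), ‖c (s + k)‖ ^ 2 := by
  have hcont : ∀ k, Continuous fun x : UnitAddCircle ↦ c k * (fourier (n k) x : ℂ) := by
    intro k; fun_prop
  have hint : ∀ g : UnitAddCircle → ℝ, Continuous g → Integrable g haarT := fun g hg ↦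
    hg.integrable_of_hasCompactSupport (HasCompactSupport.of_compactSpace g)
  induction L generalizing s with
  | zero => simp [dyadicSq]
  | succ L ih =>
    simp only [dyadicSq]
    have hB : Continuous fun x : UnitAddCircle ↦
        ‖∑ k ∈ Finset.range (2 ^ L), c (s + k) * (fourier (n (s + k)) x : ℂ)‖ ^ 2 := by fun_prop
    have hG : Continuous fun x : UnitAddCircle ↦
        dyadicSq (fun k ↦ c k * (fourier (n k) x : ℂ)) L s +
          dyadicSq (fun k ↦ c k * (fourier (n k) x : ℂ)) L (s + 2 ^ L) :=
      (continuous_dyadicSq hcont L s).add (continuous_dyadicSq hcont L _)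
    rw [integral_add (hint _ hB) (hint _ hG), integral_add (hint _ (continuous_dyadicSq hcont L s))
        (hint _ (continuous_dyadicSq hcont L _))]
    have h1 := ih s
    have h2 := ih (s + 2 ^ L)
    have h3 : ∫ x, ‖∑ k ∈ Finset.range (2 ^ L), c (s + k) * (fourier (n (s + k)) x : ℂ)‖ ^ 2 ∂haarT
        = ∑ k ∈ Finset.range (2 ^ L), ‖c (s + k)‖ ^ 2 := by
      classical
      have h5 := integral_norm_sq_sum_fourier
        ((Finset.range (2 ^ L)).filter fun k ↦ c (s + k) ≠ 0) (fun k ↦ c (s + k))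
        (fun k ↦ n (s + k)) (by
          intro i hi j hj hij
          simp only [Finset.coe_filter, Set.mem_ofPred_eq] at hi hj
          have := hn _ _ hij hi.2 hj.2
          omega)
      rw [Finset.sum_filter_of_ne (by
        intro k _ hk h; simp [h] at hk)] at h5
      rw [← h5]
      congr with x
      rw [Finset.sum_filter_of_ne (by
        intro k _ hk h; simp [h] at hk)]
    rw [h3, pow_succ, mul_two, Finset.sum_range_add]
    simp only [← add_assoc] at h2 ⊢
    have h4 : 0 ≤ ∑ k ∈ Finset.range (2 ^ L), ‖c (s + 2 ^ L + k)‖ ^ 2 := by positivity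
    push_cast
    linarith

theorem sum_norm_sq_fourierCoeff_le {ι : Type*} (s : Finset ι) (n : ι → ℤ)
    (hn : Function.Injective n) (f : L2Torus) :
    ∑ k ∈ s, ‖fourierCoeff (f : UnitAddCircle → ℂ) (n k)‖ ^ 2 ≤ ‖f‖ ^ 2 := by
  have h := orthonormal_fourier (T := 1).comp n hn |>.sum_inner_products_le f (s := s)
  refine le_trans (le_of_eq (Finset.sum_congr rfl fun k _ ↦ ?_)) h
  rw [← fourierBasis_repr, HilbertBasis.repr_apply_apply, coe_fourierBasis]
  rfl

theorem normL2L2_trigMajorant_le {N : ℕ} (σ : Equiv.Perm (Fin N)) :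
    normL2L2 (trigMajorant σ) ≤ ENNReal.ofReal (Nat.log 2 N + 1) := by
  refine iSup₂_le fun f hf ↦ eLpNorm_two_le_ofReal (by positivity) ?_
  set L := Nat.log 2 N + 1 with hL
  have hLN : N < 2 ^ L := Nat.lt_pow_succ_log_self one_lt_two N
  -- The rearranged series is padded by zero coefficients to length `2 ^ L`; the dummy frequency 0
  -- there is harmless.
  let n : ℕ → ℤ := fun k ↦ if h : k < N then ((σ ⟨k, h⟩ : ℕ) + 1 : ℤ) else 0
  let c : ℕ → ℂ := fun k ↦ if k < N then fourierCoeff (f : UnitAddCircle → ℂ) (n k) else 0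
  have hn : ∀ i j, n i = n j → c i ≠ 0 → c j ≠ 0 → i = j := by
    intro i j hij hi hj
    have hi' : i < N := by by_contra h; simp [c, h] at hi
    have hj' : j < N := by by_contra h; simp [c, h] at hj
    simp only [n, dif_pos hi', dif_pos hj', add_left_inj, Nat.cast_inj] at hij
    simpa using σ.injective (Fin.ext hij)
  have hpt : ∀ x, trigMajorant σ f x ^ 2 ≤
      L * dyadicSq (fun k ↦ c k * (fourier (n k) x : ℂ)) L 0 := by
    intro x
    have h0 := dyadicSq_nonneg (fun k ↦ c k * (fourier (n k) x : ℂ)) L 0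
    rw [← Real.sq_sqrt (mul_nonneg (Nat.cast_nonneg L) h0)]
    refine pow_le_pow_left₀ (Real.iSup_nonneg fun m ↦ norm_nonneg _) ?_ 2
    refine Real.iSup_le (fun m ↦ Real.le_sqrt_of_sq_le ?_) (Real.sqrt_nonneg _)
    have h1 := norm_sum_range_sq_le_dyadicSq (fun k ↦ c k * (fourier (n k) x : ℂ)) L 0 (m + 1)
      (by omega)
    refine le_trans (le_of_eq ?_) h1
    congr 2
    refine Finset.sum_bij (fun (k : Fin N) _ ↦ (k : ℕ)) ?_ ?_ ?_ ?_
    · intro k hk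
      have : k ≤ m := Finset.mem_Iic.1 hk
      simp only [Finset.mem_range]
      omega
    · exact fun _ _ _ _ h ↦ Fin.ext h
    · intro k hk
      have := Finset.mem_range.1 hk
      exact ⟨⟨k, by omega⟩, Finset.mem_Iic.2 (by rw [Fin.le_def]; simp; omega), rfl⟩
    · intro k _
      simp [c, n]
  have hcont := continuous_dyadicSq (a := fun (x : UnitAddCircle) k ↦ c k * (fourier (n k) x : ℂ))
    (by intro k; fun_prop) L 0
  calc ∫⁻ x, ENNReal.ofReal (trigMajorant σ f x ^ 2) ∂haarT
      ≤ ∫⁻ x, ENNReal.ofReal (L * dyadicSq (fun k ↦ c k * (fourier (n k) x : ℂ)) L 0) ∂haarT :=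
        lintegral_mono fun x ↦ ENNReal.ofReal_le_ofReal (hpt x)
    _ = ENNReal.ofReal (∫ x, L * dyadicSq (fun k ↦ c k * (fourier (n k) x : ℂ)) L 0 ∂haarT) := by
        rw [ofReal_integral_eq_lintegral_ofReal]
        · exact (continuous_const.mul hcont).integrable_of_hasCompactSupport
            (HasCompactSupport.of_compactSpace _)
        · exact Filter.Eventually.of_forall fun x ↦
            mul_nonneg (Nat.cast_nonneg L) (dyadicSq_nonneg _ _ _)
    _ ≤ _ := by
        refine ENNReal.ofReal_le_ofReal ?_
        rw [integral_const_mul]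
        have h1 := integral_dyadicSq_fourier c n L 0 hn
        have h2 : ∑ k ∈ Finset.range (2 ^ L), ‖c (0 + k)‖ ^ 2 ≤ 1 := by
          have h3 := sum_norm_sq_fourierCoeff_le Finset.univ (fun k : Fin N ↦ ((σ k : ℕ) + 1 : ℤ))
            (by intro i j h; exact σ.injective (Fin.ext (by simpa using h))) f
          have h4 : ∑ k ∈ Finset.range (2 ^ L), ‖c (0 + k)‖ ^ 2 =
              ∑ k ∈ Finset.range N, ‖c k‖ ^ 2 := by
            simp only [zero_add]
            refine (Finset.sum_subset (by simpa using hLN.le) fun k _ hk ↦ ?_).symm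
            have : ¬ k < N := by simpa using hk
            simp [c, this]
          rw [h4, ← Fin.sum_univ_eq_sum_range (fun k ↦ ‖c k‖ ^ 2)]
          refine le_trans (le_of_eq (Finset.sum_congr rfl fun k _ ↦ ?_))
            (h3.trans (pow_le_one₀ (norm_nonneg _) hf))
          simp [c, n]
        have h5 : (L : ℝ) = Nat.log 2 N + 1 := by rw [hL]; push_cast; rfl
        rw [← h5]
        have h6 : (0 : ℝ) ≤ L := Nat.cast_nonneg L
        have h7 : (L : ℝ) * ∑ k ∈ Finset.range (2 ^ L), ‖c (0 + k)‖ ^ 2 ≤ L :=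
          mul_le_of_le_one_right h6 h2
        rw [sq]
        exact mul_le_mul_of_nonneg_left (h1.trans h7) h6

/-! ### Exponential sums with weights `1 / a` -/

/-- The exponential `t ↦ exp (2 π i t)`. -/
noncomputable def expTwoPi (t : ℝ) : ℂ := Complex.exp (Complex.I * (2 * Real.pi * t : ℝ))

theorem norm_expTwoPi (t : ℝ) : ‖expTwoPi t‖ = 1 := Complex.norm_exp_I_mul_ofReal _

theorem expTwoPi_add (s t : ℝ) : expTwoPi (s + t) = expTwoPi s * expTwoPi t := by
  rw [expTwoPi, expTwoPi, expTwoPi, ← Complex.exp_add]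
  push_cast
  ring_nf

theorem expTwoPi_nat_mul (n : ℕ) (t : ℝ) : expTwoPi (n * t) = expTwoPi t ^ n := by
  rw [expTwoPi, expTwoPi, ← Complex.exp_nat_mul]
  push_cast
  ring_nf

theorem expTwoPi_nat (n : ℕ) : expTwoPi n = 1 := by
  rw [expTwoPi]
  refine Complex.exp_eq_one_iff.2 ⟨n, ?_⟩
  push_cast
  ring

theorem expTwoPi_neg (t : ℝ) : expTwoPi (-t) = (starRingEnd ℂ) (expTwoPi t) := by
  rw [expTwoPi, expTwoPi, ← Complex.exp_conj, map_mul, Complex.conj_ofReal, Complex.conj_I]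
  push_cast
  ring_nf

theorem re_expTwoPi (t : ℝ) : (expTwoPi t).re = Real.cos (2 * Real.pi * t) := by
  rw [expTwoPi, mul_comm, Complex.exp_ofReal_mul_I_re]

theorem norm_expTwoPi_sub_one_le {t : ℝ} (ht : 0 ≤ t) :
    ‖expTwoPi t - 1‖ ≤ 2 * Real.pi * t := by
  refine Real.norm_exp_I_mul_ofReal_sub_one_le.trans (le_of_eq ?_)
  rw [Real.norm_eq_abs, abs_of_nonneg (by positivity)]

theorem four_mul_le_norm_expTwoPi_sub_one {t : ℝ} (ht : 0 ≤ t) (ht2 : t ≤ 1 / 2) :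
    4 * t ≤ ‖expTwoPi t - 1‖ := by
  rw [expTwoPi, Complex.norm_exp_I_mul_ofReal_sub_one, norm_mul]
  have h1 : 2 * Real.pi * t / 2 = Real.pi * t := by ring
  have h2 : 2 / Real.pi * (Real.pi * t) ≤ Real.sin (Real.pi * t) :=
    Real.mul_le_sin (by positivity) (by nlinarith [Real.pi_pos])
  rw [← mul_assoc, div_mul_cancel₀ _ Real.pi_ne_zero] at h2
  rw [h1]
  have h3 := le_abs_self (Real.sin (Real.pi * t))
  simp only [Real.norm_eq_abs, abs_two]
  linarith

theorem norm_sum_pow_div_mul_le {z : ℂ} (hz : ‖z‖ = 1) {p q : ℕ} (hp : 1 ≤ p) (hpq : p ≤ q) :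
    ‖∑ a ∈ Finset.Ico p q, z ^ a / a‖ * ‖z - 1‖ ≤ 2 / p := by
  -- Summation by parts: the boundary terms are removed, and what remains is bounded by the
  -- telescoping sum of `1 / a - 1 / (a + 1)`.
  have key : ‖(z - 1) * (∑ a ∈ Finset.Ico p q, z ^ a / a) - z ^ q / q + z ^ p / p‖ ≤
      1 / p - 1 / q := by
    induction q, hpq using Nat.le_induction with
    | base => simp
    | succ q hq ih =>
      have hq0 : (0 : ℝ) < q := by exact_mod_cast hp.trans hq
      have hqc : (q : ℂ) ≠ 0 := by exact_mod_cast hq0.ne'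
      have hqc1 : (q : ℂ) + 1 ≠ 0 := by exact_mod_cast q.succ_ne_zero
      rw [Finset.sum_Ico_succ_top hq]
      have h1 : (z - 1) * (∑ a ∈ Finset.Ico p q, z ^ a / a + z ^ q / q) -
          z ^ (q + 1) / ((q + 1 : ℕ) : ℂ) + z ^ p / p =
          ((z - 1) * (∑ a ∈ Finset.Ico p q, z ^ a / a) - z ^ q / q + z ^ p / p) +
            z ^ (q + 1) * ((1 / q - 1 / (q + 1) : ℝ) : ℂ) := by
        push_cast
        field_simp
        ring
      rw [h1]
      refine (norm_add_le _ _).trans ?_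
      have h2 : (0 : ℝ) ≤ 1 / q - 1 / (q + 1) := by
        rw [sub_nonneg]
        exact one_div_le_one_div_of_le hq0 (by linarith)
      rw [norm_mul, norm_pow, hz, one_pow, one_mul, Complex.norm_real, Real.norm_eq_abs,
        abs_of_nonneg h2]
      push_cast
      linarith
  have h1 : ‖z ^ q / (q : ℂ)‖ = 1 / q := by simp [hz]
  have h2 : ‖z ^ p / (p : ℂ)‖ = 1 / p := by simp [hz]
  rw [mul_comm, ← norm_mul]
  have h3 : (z - 1) * (∑ a ∈ Finset.Ico p q, z ^ a / a) =
    ((z - 1) * (∑ a ∈ Finset.Ico p q, z ^ a / a) - z ^ q / q + z ^ p / p) + z ^ q / q -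
      z ^ p / p := by ring
  rw [h3]
  refine (norm_sub_le _ _).trans ?_
  have := norm_add_le ((z - 1) * (∑ a ∈ Finset.Ico p q, z ^ a / a) - z ^ q / q + z ^ p / p)
    (z ^ q / q)
  rw [h1] at this
  rw [h2]
  have : (2 : ℝ) / p = 1 / p + 1 / p := by ring
  linarith

theorem sum_Icc_one_div_le (n : ℕ) : ∑ a ∈ Finset.Icc 1 n, (1 : ℝ) / a ≤ 1 + Real.log n := by
  have := harmonic_le_one_add_log n
  rw [harmonic_eq_sum_Icc] at this
  push_cast at this
  simpa using this

theorem log_le_sum_Icc_one_div (n : ℕ) : Real.log n ≤ ∑ a ∈ Finset.Icc 1 n, (1 : ℝ) / a := by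
  have := log_add_one_le_harmonic n
  rw [harmonic_eq_sum_Icc] at this
  push_cast at this
  rcases n.eq_zero_or_pos with rfl | hn
  · simp
  · have h : Real.log n ≤ Real.log (n + 1) := by
      refine Real.log_le_log (by exact_mod_cast hn) (by linarith)
    simpa using h.trans this

/-- Terms up to `M` are bounded trivially by the harmonic sum. Beyond `M`, summation by parts gains
from `|e(-θ) - 1| ≥ 4 θ ≥ 4 / M` and leaves at most `1 / 2`. -/
theorem norm_sum_expTwoPi_div_le {M R : ℕ} (hM : 1 ≤ M) (hMR : M ≤ R) {θ : ℝ}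
    (h1 : 1 / (M : ℝ) ≤ θ) (h2 : θ ≤ 1 / 2) :
    ‖∑ a ∈ Finset.Icc 1 R, expTwoPi (-(a * θ)) / a‖ ≤ Real.log M + 3 / 2 := by
  have hM0 : (0 : ℝ) < M := by exact_mod_cast hM
  have hθ : 0 < θ := lt_of_lt_of_le (by positivity) h1
  have hs : Finset.Icc 1 R = Finset.Icc 1 M ∪ Finset.Ico (M + 1) (R + 1) := by
    ext a; simp; omega
  have hd : Disjoint (Finset.Icc 1 M) (Finset.Ico (M + 1) (R + 1)) := by
    rw [Finset.disjoint_left]; intro a; simp; omega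
  rw [hs, Finset.sum_union hd]
  have hhead : ‖∑ a ∈ Finset.Icc 1 M, expTwoPi (-(a * θ)) / a‖ ≤ 1 + Real.log M := by
    refine (norm_sum_le _ _).trans (le_trans (le_of_eq ?_) (sum_Icc_one_div_le M))
    refine Finset.sum_congr rfl fun a _ ↦ ?_
    rw [norm_div, norm_expTwoPi]; simp
  have htail : ‖∑ a ∈ Finset.Ico (M + 1) (R + 1), expTwoPi (-(a * θ)) / a‖ ≤ 1 / 2 := by
    have h3 : ∀ a : ℕ, expTwoPi (-(a * θ)) = expTwoPi (-θ) ^ a := fun a ↦ by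
      rw [← expTwoPi_nat_mul]; ring_nf
    simp only [h3]
    have h4 := norm_sum_pow_div_mul_le (norm_expTwoPi (-θ)) (p := M + 1) (q := R + 1)
      (by omega) (by omega)
    have h5 : 4 * θ ≤ ‖expTwoPi (-θ) - 1‖ := by
      have : expTwoPi (-θ) - 1 = (starRingEnd ℂ) (expTwoPi θ - 1) := by simp [expTwoPi_neg]
      rw [this, Complex.norm_conj]
      exact four_mul_le_norm_expTwoPi_sub_one hθ.le h2
    set S := ‖∑ a ∈ Finset.Ico (M + 1) (R + 1), expTwoPi (-θ) ^ a / (a : ℂ)‖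
    have h6 : S * (4 / M) ≤ 2 / M := by
      have h7 : 4 / (M : ℝ) ≤ ‖expTwoPi (-θ) - 1‖ := by
        refine le_trans ?_ h5
        rw [div_eq_mul_one_div]; linarith
      calc S * (4 / M) ≤ S * ‖expTwoPi (-θ) - 1‖ := by gcongr
        _ ≤ _ := h4
        _ ≤ 2 / M := by gcongr; simp
    rw [← mul_div_assoc, div_le_div_iff_of_pos_right hM0] at h6
    linarith
  refine (norm_add_le _ _).trans ?_
  linarith

/-! ### The sector sum -/

theorem filter_range_div_lt {a : ℕ} (ha : 1 ≤ a) {ρ : ℝ} (hρ : ρ ≤ 1) :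
    (Finset.range a).filter (fun b : ℕ ↦ (b : ℝ) / a < ρ) = Finset.range ⌈ρ * a⌉₊ := by
  have ha0 : (0 : ℝ) < a := by exact_mod_cast ha
  ext b
  simp only [Finset.mem_filter, Finset.mem_range, Nat.lt_ceil, div_lt_iff₀ ha0, and_iff_right_iff_imp]
  intro hb
  have : (b : ℝ) < a := hb.trans_le (by nlinarith)
  exact_mod_cast this

/-- A sector of the two-dimensional exponential sum with coefficients `1 / a` is large. -/
theorem le_norm_sector_sum {M : ℕ} (hM : 1 ≤ M) {x θ : ℝ} (hx : x ≤ 1 / 10)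
    (hθ : 1 / (M : ℝ) ≤ θ) (hθx : θ ≤ x) :
    Real.log M / 2 - 3 / 2 ≤ ‖∑ a ∈ Finset.Icc 1 (M ^ 2),
      ∑ b ∈ (Finset.range a).filter (fun b : ℕ ↦ (b : ℝ) / a < θ / x),
        (1 / a : ℂ) * expTwoPi (b * x - a * θ)‖ * (2 * Real.pi * x) := by
  have hM0 : (0 : ℝ) < M := by exact_mod_cast hM
  have hθ0 : 0 < θ := lt_of_lt_of_le (by positivity) hθ
  have hx0 : 0 < x := hθ0.trans_le hθx
  have hρ : θ / x ≤ 1 := (div_le_one hx0).2 hθx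
  set ρ := θ / x with hρdef
  have hρ0 : 0 < ρ := by positivity
  set w := expTwoPi x - 1 with hw
  -- Multiplying by `e(x) - 1` telescopes the geometric sum over `b`, leaving its two ends.
  have hgeom : (∑ a ∈ Finset.Icc 1 (M ^ 2),
      ∑ b ∈ (Finset.range a).filter (fun b : ℕ ↦ (b : ℝ) / a < ρ),
        (1 / a : ℂ) * expTwoPi (b * x - a * θ)) * w =
      ∑ a ∈ Finset.Icc 1 (M ^ 2), expTwoPi (⌈ρ * a⌉₊ * x - a * θ) / a -
        ∑ a ∈ Finset.Icc 1 (M ^ 2), expTwoPi (-(a * θ)) / a := by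
    rw [Finset.sum_mul, ← Finset.sum_sub_distrib]
    refine Finset.sum_congr rfl fun a ha ↦ ?_
    rw [filter_range_div_lt (Finset.mem_Icc.1 ha).1 hρ]
    have h1 : ∀ b : ℕ, expTwoPi (b * x - a * θ) = expTwoPi (-(a * θ)) * expTwoPi x ^ b :=
      fun b ↦ by
        rw [sub_eq_add_neg, expTwoPi_add, expTwoPi_nat_mul, mul_comm]
    simp only [h1]
    rw [← Finset.mul_sum, ← Finset.mul_sum, mul_assoc, mul_assoc, geom_sum_mul]
    ring
  -- Rounding up puts the phase `(⌈ρ a⌉ - ρ a) x` in `[0, 1 / 10]`, where the cosine exceeds `3 /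
  -- 4`. The range `a ≤ M²` supplies `2 log M`, which beats the `log M` lost at the other end.
  have hmain : 3 / 4 * (2 * Real.log M) ≤
      ‖∑ a ∈ Finset.Icc 1 (M ^ 2), expTwoPi (⌈ρ * a⌉₊ * x - a * θ) / (a : ℂ)‖ := by
    refine le_trans ?_ (Complex.re_le_norm _)
    rw [Complex.re_sum]
    have h1 := log_le_sum_Icc_one_div (M ^ 2)
    push_cast at h1
    rw [Real.log_pow] at h1
    calc 3 / 4 * (2 * Real.log M) ≤ 3 / 4 * ∑ a ∈ Finset.Icc 1 (M ^ 2), (1 : ℝ) / a := by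
          gcongr; exact_mod_cast h1
      _ ≤ _ := by
        rw [Finset.mul_sum]
        refine Finset.sum_le_sum fun a ha ↦ ?_
        have ha0 : (0 : ℝ) < a := by exact_mod_cast (Finset.mem_Icc.1 ha).1
        rw [Complex.div_natCast_re, re_expTwoPi, mul_one_div]
        refine div_le_div_of_nonneg_right ?_ ha0.le
        set δ := ⌈ρ * a⌉₊ * x - a * θ with hδ
        have hδ2 : δ = (⌈ρ * a⌉₊ - ρ * a) * x := by
          rw [hδ, hρdef]; field_simp
        have h2 := Nat.le_ceil (ρ * a)
        have h3 := Nat.ceil_lt_add_one (a := ρ * a) (by positivity)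
        have h4 : 0 ≤ δ := by rw [hδ2]; exact mul_nonneg (by linarith) hx0.le
        have h5 : δ ≤ 1 / 10 := by
          rw [hδ2]
          calc _ ≤ 1 * x := by gcongr; linarith
            _ ≤ _ := by linarith
        refine le_trans ?_ Real.one_sub_sq_div_two_le_cos
        have h6 : 2 * Real.pi * δ ≤ 2 * 3.15 * (1 / 10) := by
          have := Real.pi_lt_d2; gcongr
        have h7 : 0 ≤ 2 * Real.pi * δ := by positivity
        nlinarith
  have herr := norm_sum_expTwoPi_div_le hM (by nlinarith : M ≤ M ^ 2) hθ (by linarith)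
  have hw2 : ‖w‖ ≤ 2 * Real.pi * x := norm_expTwoPi_sub_one_le hx0.le
  calc Real.log M / 2 - 3 / 2 ≤ _ := by
        have := norm_sub_norm_le
          (∑ a ∈ Finset.Icc 1 (M ^ 2), expTwoPi (⌈ρ * a⌉₊ * x - a * θ) / (a : ℂ))
          (∑ a ∈ Finset.Icc 1 (M ^ 2), expTwoPi (-(a * θ)) / (a : ℂ))
        refine le_trans ?_ this
        linarith
    _ = _ := by rw [← hgeom, norm_mul]
    _ ≤ _ := by gcongr

/-! ### Digit pairs, prescribed coefficients and sorted partial sums -/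

theorem sum_fin_divMod {E : Type*} [AddCommMonoid E] {N R : ℕ} (hR : 1 ≤ R) (hN : R ^ 2 + R ≤ N)
    (g : ℕ → ℕ → E) :
    ∑ k : Fin N, (if ((k : ℕ) + 1) % R < ((k : ℕ) + 1) / R ∧ ((k : ℕ) + 1) / R ≤ R then
        g (((k : ℕ) + 1) / R) (((k : ℕ) + 1) % R) else 0) =
      ∑ a ∈ Finset.Icc 1 R, ∑ b ∈ Finset.range a, g a b := by
  rw [← Finset.sum_filter, Finset.sum_sigma']
  refine Finset.sum_bij (fun k _ ↦ ⟨((k : ℕ) + 1) / R, ((k : ℕ) + 1) % R⟩) ?_ ?_ ?_ ?_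
  · intro k hk
    simp only [Finset.mem_filter, Finset.mem_univ, true_and] at hk
    simp only [Finset.mem_sigma, Finset.mem_Icc, Finset.mem_range]
    omega
  · intro k _ l _ h
    simp only [Sigma.mk.injEq, heq_eq_eq] at h
    have h1 := Nat.div_add_mod ((k : ℕ) + 1) R
    have h2 := Nat.div_add_mod ((l : ℕ) + 1) R
    rw [h.1, h.2] at h1
    exact Fin.ext (by omega)
  · rintro ⟨a, b⟩ h
    simp only [Finset.mem_sigma, Finset.mem_Icc, Finset.mem_range] at h
    obtain ⟨⟨ha1, haR⟩, hba⟩ := h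
    have hbR : b < R := hba.trans_le haR
    have h1 : R * a ≤ R ^ 2 := by rw [sq]; gcongr
    have h2 : 1 ≤ R * a := Nat.mul_pos hR ha1
    have h3 : R * a + b - 1 + 1 = R * a + b := by omega
    have h4 : (R * a + b) / R = a := by
      rw [Nat.mul_add_div hR, Nat.div_eq_of_lt hbR, add_zero]
    have h5 : (R * a + b) % R = b := by
      rw [Nat.mul_add_mod, Nat.mod_eq_of_lt hbR]
    refine ⟨⟨R * a + b - 1, by omega⟩, ?_, ?_⟩
    · simp only [Finset.mem_filter, Finset.mem_univ, true_and, h3, h4, h5]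
      exact ⟨hba, haR⟩
    · simp only [h3, h4, h5]
  · intro k _
    rfl

theorem exists_fourierCoeff_eq {N : ℕ} (c : Fin N → ℂ) :
    ∃ f : L2Torus, ‖f‖ ^ 2 = ∑ k, ‖c k‖ ^ 2 ∧
      ∀ k : Fin N, fourierCoeff (f : UnitAddCircle → ℂ) ((k : ℕ) + 1 : ℤ) = c k := by
  have ho : Orthonormal ℂ fun k : Fin N ↦ fourierLp (T := 1) 2 ((k : ℕ) + 1 : ℤ) :=
    orthonormal_fourier.comp _ fun i j h ↦ Fin.ext (by simpa using h)
  refine ⟨∑ k, c k • fourierLp 2 ((k : ℕ) + 1 : ℤ), ?_, fun k ↦ ?_⟩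
  · have h := ho.inner_sum c c Finset.univ
    have h2 : ((‖∑ k, c k • fourierLp (T := 1) 2 ((k : ℕ) + 1 : ℤ)‖ ^ 2 : ℝ) : ℂ) =
        ((∑ k, ‖c k‖ ^ 2 : ℝ) : ℂ) := by
      push_cast
      simp only [← Complex.conj_mul' (c _)]
      rw [← h, inner_self_eq_norm_sq_to_K]
      rfl
    exact_mod_cast h2
  · rw [← fourierBasis_repr, HilbertBasis.repr_apply_apply, coe_fourierBasis]
    exact ho.inner_right_fintype c k

/-- After sorting by `key`, each sublevel set is an initial segment, so its sum is one of the
partial sums in the maximum, or is empty. -/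
theorem norm_sum_filter_lt_le_trigMajorant {N : ℕ} (key : Fin N → ℝ) (f : L2Torus)
    (x : UnitAddCircle) (ρ : ℝ) :
    ‖∑ k with key k < ρ, fourierCoeff (f : UnitAddCircle → ℂ) ((k : ℕ) + 1 : ℤ) *
      (fourier ((k : ℕ) + 1 : ℤ) x : ℂ)‖ ≤ trigMajorant (Tuple.sort key) f x := by
  set σ := Tuple.sort key
  have hmono : Monotone (key ∘ σ) := Tuple.monotone_sort key
  have hre : ∑ k with key k < ρ, fourierCoeff (f : UnitAddCircle → ℂ) ((k : ℕ) + 1 : ℤ) *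
      (fourier ((k : ℕ) + 1 : ℤ) x : ℂ) =
      ∑ k with key (σ k) < ρ, fourierCoeff (f : UnitAddCircle → ℂ) ((σ k : ℕ) + 1 : ℤ) *
      (fourier ((σ k : ℕ) + 1 : ℤ) x : ℂ) := by
    rw [Finset.sum_filter, Finset.sum_filter, ← Equiv.sum_comp σ]
  rw [hre]
  rcases (Finset.univ.filter fun k ↦ key (σ k) < ρ).eq_empty_or_nonempty with h | h
  · rw [h]
    rw [Finset.sum_empty, norm_zero]
    exact Real.iSup_nonneg fun m ↦ norm_nonneg _
  · set m := (Finset.univ.filter fun k ↦ key (σ k) < ρ).max' h with hm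
    have hmem := Finset.max'_mem _ h
    have hIic : (Finset.univ.filter fun k ↦ key (σ k) < ρ) = Finset.Iic m := by
      ext k
      simp only [Finset.mem_filter, Finset.mem_univ, true_and, Finset.mem_Iic]
      constructor
      · intro hk
        exact Finset.le_max' _ _ (by simpa using hk)
      · intro hk
        exact (hmono hk).trans_lt (by simpa [← hm] using hmem)
    rw [hIic]
    exact le_ciSup (f := fun m : Fin N ↦ ‖∑ k ∈ Finset.Iic m,
      fourierCoeff (f : UnitAddCircle → ℂ) ((σ k : ℕ) + 1 : ℤ) *
        (fourier ((σ k : ℕ) + 1 : ℤ) x : ℂ)‖) (Set.finite_range _).bddAbove m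

/-! ### Integrals over disjoint intervals, and a bound for small `N` -/

theorem sum_ofReal_mul_le_lintegral (h : UnitAddCircle → ENNReal) (s : Finset ℕ) (l u V : ℕ → ℝ)
    (hdisj : ∀ i ∈ s, ∀ j ∈ s, i < j → u i < l j) (hl : ∀ i ∈ s, 0 < l i) (hu : ∀ i ∈ s, u i ≤ 1)
    (hV : ∀ i ∈ s, 0 ≤ V i)
    (hh : ∀ i ∈ s, ∀ x ∈ Set.Icc (l i) (u i), ENNReal.ofReal (V i) ≤ h x) :
    ∑ i ∈ s, ENNReal.ofReal (V i * (u i - l i)) ≤ ∫⁻ x, h x ∂haarT := by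
  have hvol : haarT = (volume : Measure UnitAddCircle) := by
    rw [AddCircle.volume_eq_smul_haarAddCircle]; simp
  rw [hvol, ← UnitAddCircle.lintegral_preimage 0 h]
  calc ∑ i ∈ s, ENNReal.ofReal (V i * (u i - l i))
      ≤ ∑ i ∈ s, ∫⁻ x in Set.Icc (l i) (u i), h (x : UnitAddCircle) := by
        refine Finset.sum_le_sum fun i hi ↦ ?_
        rw [ENNReal.ofReal_mul (hV i hi), ← Real.volume_Icc, ← setLIntegral_const]
        exact setLIntegral_mono' measurableSet_Icc fun x hx ↦ hh i hi x hx
    _ = ∫⁻ x in ⋃ i ∈ s, Set.Icc (l i) (u i), h (x : UnitAddCircle) := by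
        rw [lintegral_biUnion_finset _ fun i _ ↦ measurableSet_Icc]
        intro i hi j hj hij
        refine Set.disjoint_left.2 fun x hxi hxj ↦ ?_
        rcases lt_or_gt_of_ne hij with hlt | hlt
        · linarith [hdisj i hi j hj hlt, hxi.2, hxj.1]
        · linarith [hdisj j hj i hi hlt, hxi.1, hxj.2]
    _ ≤ _ := by
        refine lintegral_mono_set (Set.iUnion₂_subset fun i hi x hx ↦ ?_)
        exact ⟨(hl i hi).trans_le hx.1, hx.2.trans (by linarith [hu i hi])⟩

/-- A single exponential already has majorant at least 1; this handles bounded `N`. -/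
theorem one_le_normL2L2_trigMajorant {N : ℕ} (hN : 1 ≤ N) (σ : Equiv.Perm (Fin N)) :
    1 ≤ normL2L2 (trigMajorant σ) := by
  have : NeZero N := ⟨by omega⟩
  obtain ⟨f, hf, hc⟩ := exists_fourierCoeff_eq (N := N) (fun k ↦ if k = 0 then 1 else 0)
  have hf1 : ‖f‖ ≤ 1 := by
    have : ‖f‖ ^ 2 = 1 := by rw [hf, Finset.sum_eq_single 0] <;> simp +contextual
    nlinarith [norm_nonneg f]
  refine le_trans ?_ (le_iSup₂ (f := fun (f : L2Torus) (_ : ‖f‖ ≤ 1) ↦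
    eLpNorm (trigMajorant σ f) 2 haarT) f hf1)
  rw [← ENNReal.ofReal_one]
  refine ofReal_le_eLpNorm_two ?_
  have h1 : ∀ x, 1 ≤ trigMajorant σ f x := by
    intro x
    refine le_trans ?_ (le_ciSup (f := fun m : Fin N ↦ ‖∑ k ∈ Finset.Iic m,
      fourierCoeff (f : UnitAddCircle → ℂ) ((σ k : ℕ) + 1 : ℤ) *
        (fourier ((σ k : ℕ) + 1 : ℤ) x : ℂ)‖) (Set.finite_range _).bddAbove (σ.symm 0))
    simp only [hc]
    rw [Finset.sum_eq_single (σ.symm 0)]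
    · rw [Equiv.apply_symm_apply, if_pos rfl, one_mul, fourier_apply, Circle.norm_coe]
    · intro k _ hk
      rw [if_neg (by intro h; exact hk (by rw [← h]; simp)), zero_mul]
    · simp
  calc ENNReal.ofReal (1 ^ 2) = ∫⁻ _, 1 ∂haarT := by simp
    _ ≤ _ := lintegral_mono fun x ↦ by
      rw [← ENNReal.ofReal_one]
      exact ENNReal.ofReal_le_ofReal (one_le_pow₀ (h1 x))

/-! ### The lower bound for the order by slope -/

theorem fourier_natCast_add_one (k : ℕ) (x : ℝ) :
    (fourier ((k : ℤ) + 1) (x : UnitAddCircle) : ℂ) = expTwoPi (((k + 1 : ℕ) : ℝ) * x) := by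
  rw [fourier_coe_apply, expTwoPi]
  push_cast
  ring_nf

/-- The sum is about `log (M² / 10) - log (4 M)`, that is, `log M` minus a constant; the threshold
11 makes half of `log M` absorb that constant. -/
theorem log_div_two_le_sum_Icc {M : ℕ} (hM : 1 ≤ M) (hlog : 11 ≤ Real.log M) :
    Real.log M / 2 ≤ ∑ i ∈ Finset.Icc (4 * M) (M ^ 2 / 10), (1 : ℝ) / i := by
  have hM0 : (0 : ℝ) < M := by exact_mod_cast hM
  have hMlarge : (40 : ℝ) ≤ M := by
    have h := Real.exp_le_exp.2 hlog
    rw [Real.exp_log hM0] at h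
    have h2 : (2 : ℝ) ≤ Real.exp 1 := by linarith [Real.add_one_le_exp 1]
    have h3 : (2 : ℝ) ^ 11 ≤ Real.exp 11 := by
      calc (2 : ℝ) ^ 11 ≤ Real.exp 1 ^ 11 := by gcongr
        _ = _ := by rw [← Real.exp_nat_mul]; norm_num
    linarith
  have hM40 : 40 ≤ M := by exact_mod_cast hMlarge
  have h4T : 4 * M ≤ M ^ 2 / 10 := by
    rw [Nat.le_div_iff_mul_le (by norm_num)]
    nlinarith
  set T := M ^ 2 / 10 with hT
  have hsplit : ∑ i ∈ Finset.Icc 1 T, (1 : ℝ) / i ≤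
      ∑ i ∈ Finset.Icc 1 (4 * M), (1 : ℝ) / i + ∑ i ∈ Finset.Icc (4 * M) T, (1 : ℝ) / i := by
    have hs : Finset.Icc 1 T ⊆ Finset.Icc 1 (4 * M) ∪ Finset.Icc (4 * M) T := by
      intro i; simp; omega
    rw [← Finset.sum_union_inter]
    have h1 : 0 ≤ ∑ i ∈ Finset.Icc 1 (4 * M) ∩ Finset.Icc (4 * M) T, (1 : ℝ) / i := by positivity
    have h2 := Finset.sum_le_sum_of_subset_of_nonneg (f := fun i : ℕ ↦ (1 : ℝ) / i) hs
      fun i _ _ ↦ by positivity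
    linarith
  have h1 := sum_Icc_one_div_le (4 * M)
  have h2 := log_add_one_le_harmonic T
  rw [harmonic_eq_sum_Icc] at h2
  push_cast at h2
  simp only [← one_div] at h2
  have h3 : (M : ℝ) ^ 2 / 10 ≤ T + 1 := by
    have : M ^ 2 < (T + 1) * 10 := by omega
    have : (M : ℝ) ^ 2 < (T + 1) * 10 := by exact_mod_cast this
    linarith
  have h4 := Real.log_le_log (by positivity) h3
  rw [Real.log_div (by positivity) (by norm_num), Real.log_pow] at h4
  push_cast at h1 h4
  rw [Real.log_mul (by norm_num) hM0.ne'] at h1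
  have h5 : Real.log 4 = 2 * Real.log 2 := by
    rw [← Real.log_rpow (by norm_num)]; norm_num
  have h6 : Real.log 10 ≤ 4 * Real.log 2 := by
    rw [← Real.log_rpow (by norm_num)]
    exact Real.log_le_log (by norm_num) (by norm_num)
  have h7 := Real.log_two_lt_d9
  linarith

/-- The ratio `b / a` of the digits `a, b` of the frequency `k + 1 = R * a + b`. -/
noncomputable def digitSlope (R : ℕ) {N : ℕ} (k : Fin N) : ℝ :=
  ((((k : ℕ) + 1) % R : ℕ) : ℝ) / ((((k : ℕ) + 1) / R : ℕ) : ℝ)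

/-- The coefficient `B / a` on the frequencies `k + 1 = R * a + b` with `b < a ≤ R`. -/
noncomputable def sectorCoeff (R : ℕ) (B : ℝ) {N : ℕ} (k : Fin N) : ℂ :=
  if ((k : ℕ) + 1) % R < ((k : ℕ) + 1) / R ∧ ((k : ℕ) + 1) / R ≤ R then
    (B : ℂ) * (1 / ((((k : ℕ) + 1) / R : ℕ) : ℂ)) else 0

theorem sum_norm_sq_sectorCoeff {N R : ℕ} (hR : 1 ≤ R) (hN : R ^ 2 + R ≤ N) (B : ℝ) :
    ∑ k : Fin N, ‖sectorCoeff R B k‖ ^ 2 = B ^ 2 * ∑ a ∈ Finset.Icc 1 R, (1 : ℝ) / a := by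
  have h := sum_fin_divMod hR hN fun a _ ↦ ‖(B : ℂ) * (1 / (a : ℂ))‖ ^ 2
  simp only [Finset.sum_const, Finset.card_range, nsmul_eq_mul] at h
  rw [Finset.mul_sum]
  refine Eq.trans (Finset.sum_congr rfl fun k _ ↦ ?_) (h.trans (Finset.sum_congr rfl fun a ha ↦ ?_))
  · rw [sectorCoeff]
    split_ifs <;> simp
  · have ha0 : (a : ℝ) ≠ 0 := by
      have := (Finset.mem_Icc.1 ha).1
      exact_mod_cast (by omega : a ≠ 0)
    simp only [norm_mul, norm_div, norm_one, Complex.norm_real, Complex.norm_natCast,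
      Real.norm_eq_abs, mul_pow, sq_abs]
    field_simp

theorem sum_sectorCoeff_mul_fourier {N R : ℕ} (hR : 1 ≤ R) (hN : R ^ 2 + R ≤ N) (B ρ x : ℝ)
    (i : ℕ) :
    ∑ k : Fin N with digitSlope R k < ρ, sectorCoeff R B k *
      (fourier ((k : ℕ) + 1 : ℤ) (x : UnitAddCircle) : ℂ) =
    B * ∑ a ∈ Finset.Icc 1 R, ∑ b ∈ (Finset.range a).filter (fun b : ℕ ↦ (b : ℝ) / a < ρ),
        (1 / a : ℂ) * expTwoPi (b * x - a * (i - R * x)) := by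
  have h := sum_fin_divMod hR hN fun a b ↦ if (b : ℝ) / a < ρ then
    B * ((1 / a : ℂ) * expTwoPi (b * x - a * (i - R * x))) else 0
  simp only [← Finset.sum_filter (fun b : ℕ ↦ (b : ℝ) / _ < ρ), ← Finset.mul_sum] at h
  rw [Finset.mul_sum, Finset.sum_filter]
  simp only [Finset.mul_sum] at h ⊢
  rw [← h]
  refine Finset.sum_congr rfl fun k _ ↦ ?_
  have hk : (((k + 1 : ℕ) : ℝ)) =
      R * (((k + 1) / R : ℕ) : ℝ) + (((k + 1) % R : ℕ) : ℝ) := by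
    exact_mod_cast (Nat.div_add_mod ((k : ℕ) + 1) R).symm
  have he : (fourier ((k : ℕ) + 1 : ℤ) (x : UnitAddCircle) : ℂ) =
      expTwoPi ((((k + 1) % R : ℕ) : ℝ) * x - (((k + 1) / R : ℕ) : ℝ) * (i - R * x)) := by
    -- Here `(R a + b) x = a i + (b x - a (i - R x))`, and the integer `a i` drops out of the
    -- exponential.
    rw [fourier_natCast_add_one, hk, ← one_mul (expTwoPi (_ - _)),
      ← expTwoPi_nat (((k + 1) / R) * i), ← expTwoPi_add]
    push_cast
    ring_nf
  rw [he, digitSlope, sectorCoeff]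
  split_ifs <;> ring

theorem le_normL2L2_trigMajorant_sort {M N : ℕ} (hM : 1 ≤ M) (hlog : 11 ≤ Real.log M)
    (hN : M ^ 4 + M ^ 2 ≤ N) :
    ENNReal.ofReal (Real.log M / 160) ≤
      normL2L2 (trigMajorant (Tuple.sort (digitSlope (M ^ 2) : Fin N → ℝ))) := by
  set R := M ^ 2 with hRdef
  have hM0 : (0 : ℝ) < M := by exact_mod_cast hM
  have hR : 1 ≤ R := Nat.pos_of_ne_zero (by positivity)
  have hR0 : (0 : ℝ) < R := by exact_mod_cast hR
  have hRM : (R : ℝ) = M ^ 2 := by rw [hRdef]; push_cast; rfl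
  have hN' : R ^ 2 + R ≤ N := by rw [hRdef, ← pow_mul]; exact hN
  -- Normalization: the harmonic sum up to `R = M²` is at most `1 + 2 log M ≤ 3 log M`.
  set B := (Real.sqrt (3 * Real.log M))⁻¹ with hB
  have hB0 : 0 < B := by positivity
  have hB2 : B ^ 2 = 1 / (3 * Real.log M) := by
    rw [hB, inv_pow, Real.sq_sqrt (by positivity), one_div]
  obtain ⟨f, hf, hc⟩ := exists_fourierCoeff_eq (sectorCoeff R B : Fin N → ℂ)
  have hf1 : ‖f‖ ≤ 1 := by
    rw [sum_norm_sq_sectorCoeff hR hN'] at hf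
    have h1 := sum_Icc_one_div_le R
    rw [hRM, Real.log_pow] at h1
    push_cast at h1
    have h2 : ‖f‖ ^ 2 ≤ 1 := by
      rw [hf, hB2, one_div_mul_eq_div, div_le_one (by positivity)]
      linarith
    nlinarith [norm_nonneg f]
  refine le_trans ?_ (le_iSup₂ (f := fun (f : L2Torus) (_ : ‖f‖ ≤ 1) ↦
    eLpNorm (trigMajorant (Tuple.sort (digitSlope R : Fin N → ℝ)) f) 2 haarT) f hf1)
  refine ofReal_le_eLpNorm_two ?_
  -- The bound `i ≥ 4 M` ensures `θ ≥ 1 / M`, and `i ≤ R / 10` ensures `x ≤ 1 / 10`.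
  set s := Finset.Icc (4 * M) (R / 10)
  have hs : ∀ i ∈ s, 4 * (M : ℝ) ≤ i ∧ (i : ℝ) ≤ R / 10 := by
    intro i hi
    have h := Finset.mem_Icc.1 hi
    refine ⟨by exact_mod_cast h.1, ?_⟩
    rw [le_div_iff₀ (by norm_num)]
    have := h.2
    exact_mod_cast (by omega : i * 10 ≤ R)
  have hsmall : ∀ i ∈ s, (i : ℝ) / (2 * R) ≤ 1 / 20 := by
    intro i hi
    rw [div_le_iff₀ (by positivity)]
    linarith [(hs i hi).2]
  -- These endpoints correspond to `i / (4 R) ≤ θ ≤ i / (2 R)` for `θ = i - R x`.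
  set l : ℕ → ℝ := fun i ↦ (i - i / (2 * R)) / R with hl
  set u : ℕ → ℝ := fun i ↦ (i - i / (4 * R)) / R with hu
  set V : ℕ → ℝ := fun i ↦ Real.log M * R ^ 2 / (3072 * i ^ 2) with hV
  refine le_trans ?_ (sum_ofReal_mul_le_lintegral _ s l u V ?_ ?_ ?_ ?_ ?_)
  · have hVl : ∀ i ∈ s, V i * (u i - l i) = Real.log M / 12288 * (1 / i) := by
      intro i hi
      have : (0 : ℝ) < i := by linarith [(hs i hi).1]
      simp only [hV, hu, hl]
      field_simp
      ring
    rw [← ENNReal.ofReal_sum_of_nonneg (fun i hi ↦ by rw [hVl i hi]; positivity),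
      Finset.sum_congr rfl hVl, ← Finset.mul_sum]
    refine ENNReal.ofReal_le_ofReal ?_
    have h1 := log_div_two_le_sum_Icc hM hlog
    -- The total is at least `(log M)² / 24576`, which exceeds `(log M / 160)²`.
    have h2 : Real.log M / 12288 * (Real.log M / 2) ≤
        Real.log M / 12288 * ∑ i ∈ s, (1 : ℝ) / i := by gcongr
    nlinarith
  · intro i hi j hj hij
    simp only [hu, hl]
    have h1 : (i : ℝ) + 1 ≤ j := by exact_mod_cast hij
    have h2 := hsmall j hj
    have h3 : (0 : ℝ) ≤ i / (4 * R) := by positivity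
    rw [div_lt_div_iff_of_pos_right hR0]
    linarith
  · intro i hi
    have h1 := hsmall i hi
    have h2 := (hs i hi).1
    have h3 : (1 : ℝ) ≤ M := by exact_mod_cast hM
    exact div_pos (by linarith) hR0
  · intro i hi
    rw [div_le_one hR0]
    have h3 : (0 : ℝ) ≤ i / (4 * R) := by positivity
    linarith [(hs i hi).2]
  · intro i hi
    simp only [hV]
    positivity
  · intro i hi x hx
    obtain ⟨hi1, hi2⟩ := hs i hi
    have hi0 : (0 : ℝ) < i := by linarith
    have hx1 := hx.1
    have hx2 := hx.2
    simp only [hl, hu, div_le_iff₀ hR0, le_div_iff₀ hR0] at hx1 hx2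
    set θ : ℝ := i - R * x with hθ
    have hθ1 : (i : ℝ) / (4 * R) ≤ θ := by rw [hθ]; linarith
    have hθ2 : θ ≤ i / (2 * R) := by rw [hθ]; linarith
    have hMθ : 1 / (M : ℝ) ≤ θ := by
      refine le_trans ?_ hθ1
      rw [hRM, div_le_div_iff₀ hM0 (by positivity)]
      nlinarith
    have hxi : x ≤ i / R := by
      rw [le_div_iff₀ hR0]
      have : (0 : ℝ) ≤ i / (4 * R) := by positivity
      linarith
    have hθx : θ ≤ x := by
      refine hθ2.trans ?_
      have h1 : (i : ℝ) / (2 * R) ≤ i / 2 := by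
        have : (1 : ℝ) ≤ R := by exact_mod_cast hR
        gcongr
        linarith
      have h2 : (i : ℝ) / (2 * R) = (i / 2) / R := by field_simp
      rw [h2, div_le_iff₀ hR0]
      linarith
    have hx10 : x ≤ 1 / 10 := by
      refine hxi.trans ?_
      rw [div_le_iff₀ hR0]
      linarith
    have hx0 : 0 < x := lt_of_lt_of_le (lt_of_lt_of_le (by positivity) hMθ) hθx
    have hS := le_norm_sector_sum hM hx10 hMθ hθx
    have hT := norm_sum_filter_lt_le_trigMajorant (digitSlope R : Fin N → ℝ) f x (θ / x)
    simp only [hc] at hT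
    rw [sum_sectorCoeff_mul_fourier hR hN' B (θ / x) x i, norm_mul, Complex.norm_real,
      Real.norm_eq_abs, abs_of_pos hB0, ← hθ] at hT
    set S := ‖∑ a ∈ Finset.Icc 1 R,
      ∑ b ∈ (Finset.range a).filter (fun b : ℕ ↦ (b : ℝ) / a < θ / x),
        (1 / a : ℂ) * expTwoPi (b * x - a * θ)‖
    -- From `2 π x ≤ 8 i / R` and `log M / 2 - 3 / 2 ≥ log M / 4`.
    have hS2 : Real.log M * R / (32 * i) ≤ S := by
      rw [div_le_iff₀ (by positivity)]
      have h1 : S * (2 * Real.pi * x) ≤ S * (8 * (i / R)) := by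
        have : 2 * Real.pi * x ≤ 8 * (i / R) := by
          have := Real.pi_le_four
          gcongr
          linarith
        gcongr
      have h2 : Real.log M / 4 ≤ S * (8 * (i / R)) := by linarith
      have h3 : S * (8 * (i / R)) = S * (8 * i) / R := by ring
      rw [h3, le_div_iff₀ hR0] at h2
      linarith
    refine ENNReal.ofReal_le_ofReal ?_
    calc V i = (B * (Real.log M * R / (32 * i))) ^ 2 := by
          rw [mul_pow, hB2]
          simp only [hV]
          have : Real.log M ≠ 0 := by linarith
          field_simp
          ring
      _ ≤ (B * S) ^ 2 := by gcongr
      _ ≤ _ := by gcongr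

/-! ### Both bounds for every `N` -/

theorem theorem1 :
    ∃ c C : ℝ, 0 < c ∧ 0 < C ∧ ∀ N : ℕ, 1 < N →
      ∃ σ : Equiv.Perm (Fin N),
        ENNReal.ofReal (c * Real.log N) ≤ normL2L2 (trigMajorant σ) ∧
        normL2L2 (trigMajorant σ) ≤ ENNReal.ofReal (C * Real.log N) := by
  -- The lower constant is `1 / (8 · 160)`, since `log N ≤ 4 log (M + 2) ≤ 8 log M` below. For the
  -- upper one, `log₂ N + 1 ≤ 2 log N / log 2 ≤ 4 log N`.
  refine ⟨1 / 1280, 4, by norm_num, by norm_num, fun N hN ↦ ?_⟩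
  have hN0 : (0 : ℝ) < N := by exact_mod_cast (by omega : 0 < N)
  have hupper : ∀ σ : Equiv.Perm (Fin N),
      normL2L2 (trigMajorant σ) ≤ ENNReal.ofReal (4 * Real.log N) := by
    intro σ
    refine (normL2L2_trigMajorant_le σ).trans (ENNReal.ofReal_le_ofReal ?_)
    have h1 : Real.log 2 ≤ Real.log N :=
      Real.log_le_log (by norm_num) (by exact_mod_cast hN)
    have h2 : (Nat.log 2 N : ℝ) * Real.log 2 ≤ Real.log N := by
      rw [← Real.log_pow]
      refine Real.log_le_log (by positivity) ?_
      exact_mod_cast Nat.pow_log_le_self 2 (by omega)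
    have h3 := Real.log_two_gt_d9
    have h4 : (0 : ℝ) ≤ Nat.log 2 N := Nat.cast_nonneg _
    nlinarith
  suffices h : ∃ σ : Equiv.Perm (Fin N),
      ENNReal.ofReal (1 / 1280 * Real.log N) ≤ normL2L2 (trigMajorant σ) by
    obtain ⟨σ, hσ⟩ := h
    exact ⟨σ, hσ, hupper σ⟩
  by_cases hsmall : Real.log N ≤ 1280
  · refine ⟨1, le_trans ?_ (one_le_normL2L2_trigMajorant (by omega) 1)⟩
    rw [← ENNReal.ofReal_one]
    exact ENNReal.ofReal_le_ofReal (by linarith)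
  push Not at hsmall
  -- Shifting the integer fourth root down by one leaves room for `M ^ 4 + M ^ 2 ≤ (M + 1) ^ 4 ≤ N`.
  obtain ⟨M, hMN, hNM⟩ : ∃ M : ℕ, (M + 1) ^ 4 ≤ N ∧ N < (M + 2) ^ 4 := by
    have h1 := Nat.sqrt_le' N
    have h2 := Nat.lt_succ_sqrt' N
    have h3 := Nat.sqrt_le' N.sqrt
    have h4 := Nat.lt_succ_sqrt' N.sqrt
    have h5 : 0 < N.sqrt.sqrt := Nat.sqrt_pos.2 (Nat.sqrt_pos.2 (by omega))
    refine ⟨N.sqrt.sqrt - 1, ?_, ?_⟩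
    · rw [Nat.sub_add_cancel h5]
      calc N.sqrt.sqrt ^ 4 = (N.sqrt.sqrt ^ 2) ^ 2 := by ring
        _ ≤ N.sqrt ^ 2 := by gcongr
        _ ≤ N := h1
    · have h6 : N.sqrt.sqrt - 1 + 2 = N.sqrt.sqrt + 1 := by omega
      rw [h6]
      calc N < (N.sqrt + 1) ^ 2 := h2
        _ ≤ ((N.sqrt.sqrt + 1) ^ 2) ^ 2 := by gcongr; exact h4
        _ = _ := by ring
  have hlogN : Real.log N ≤ 4 * Real.log (M + 2) := by
    have h : Real.log N ≤ Real.log (((M + 2 : ℕ) : ℝ) ^ 4) :=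
      Real.log_le_log hN0 (by exact_mod_cast hNM.le)
    rw [Real.log_pow] at h
    push_cast at h
    exact h
  have hM : 2 ≤ M := by
    by_contra h
    have h1 : ((M : ℝ) + 2) ≤ 3 := by
      have : M ≤ 1 := by omega
      have : (M : ℝ) ≤ 1 := by exact_mod_cast this
      linarith
    have h2 := Real.log_le_sub_one_of_pos (by positivity : (0 : ℝ) < M + 2)
    linarith
  have hM2 : (2 : ℝ) ≤ M := by exact_mod_cast hM
  have hlogM : Real.log (M + 2) ≤ 2 * Real.log M := by
    have h : Real.log (M + 2) ≤ Real.log ((M : ℝ) ^ 2) :=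
      Real.log_le_log (by positivity) (by nlinarith)
    rw [Real.log_pow] at h
    push_cast at h
    exact h
  refine ⟨_, le_trans (ENNReal.ofReal_le_ofReal ?_)
    (le_normL2L2_trigMajorant_sort (M := M) (by omega) (by linarith) ?_)⟩
  · linarith
  · refine le_trans ?_ hMN
    nlinarith [Nat.zero_le (M ^ 3), Nat.zero_le (M ^ 2)]
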